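/- **Proposition.** Let $d \ge 2$ and $k \in \mathbb{N}$ be integers ($k \geq 0$), and let $G$ be a $d$-regular Borel forest, that is, an acyclic graph in which every vertex has exactly $d$ neighbours, whose vertex set $V(G)$ is a standard Borel space and whose edge set is a Borel subset of $V(G)^2$. Then $G$ admits a Borel homomorphism to the Kneser graph $K(dk+1,k)$ (a Borel $k$-fold $(dk+1)$-colouring): there is a Borel map $f$ from $V(G)$ to the finite discrete set of $k$-element subsets of $\{0,1,\dots,dk\}$ such that $f(x) \cap f(y) = \emptyset$ whenever $x$ and $y$ are adjacent in $G$. Here $K(n,k)$ is the graph whose vertices are the $k$-element subsets of $\{0,\dots,n-1\}$, two of them being adjacent if they are disjoint. -/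

import Mathlib

/-- A graph on a space with a σ-algebra is Borel if its edge set is a measurable subset of the
product space; the vertex space is required to be standard Borel wherever this is used. -/
def IsBorelGraph {V : Type*} [MeasurableSpace V] (G : SimpleGraph V) : Prop :=
  MeasurableSet {p : V × V | G.Adj p.1 p.2}

/-- The vertices of the Kneser graph `K(n,k)`: the `k`-element subsets of `{0, …, n - 1}`. -/
def KneserVertex (n k : ℕ) : Type := {A : Finset (Fin n) // A.card = k}

/-- The finite vertex set of a Kneser graph carries the discrete Borel structure. -/
instance kneserVertexMeasurableSpace (n k : ℕ) : MeasurableSpace (KneserVertex n k) := ⊤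

/-- The Kneser graph `K(n,k)`: two `k`-element subsets of an `n`-element set are adjacent if they
are disjoint. For `k ≥ 1` this is a simple graph (symmetric and loopless). For `k = 0` its only
vertex, the empty set, is disjoint from itself and so carries a loop, which is why `Digraph`, a
plain adjacency relation, is used here and not `SimpleGraph`. -/
def kneserGraph (n k : ℕ) : Digraph (KneserVertex n k) where
  Adj A B := Disjoint A.1 B.1

/-- `f` is a Borel homomorphism from the graph `G` to the graph `H`: it is measurable as a map on
vertices and maps edges to edges. -/
def IsBorelHom {V W : Type*} [MeasurableSpace V] [MeasurableSpace W]
    (G : SimpleGraph V) (H : Digraph W) (f : V → W) : Prop :=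
  Measurable f ∧ ∀ x y : V, G.Adj x y → H.Adj (f x) (f y)

/-! A vertex with one uncoloured neighbour sees at most `(d-1)k` used colours and so keeps `k+1`
free ones: greedy colouring works as long as each vertex still has an uncoloured neighbour. So a
Borel set of pairwise nonadjacent induced paths with `2k+1` edges, at bounded distance from every
vertex, is left for the end, and all else is coloured towards it, each vertex before some neighbour
nearer to the paths (`nonempty_pathLayout`, `exists_measurable_family`).

The ends of a path then keep lists of at least `k+1` colours and its inner vertices lists of at
least `2k+1`. Disjoint `k`-sets can be chosen from such lists along the path: the sets known to be
admissible at position `i` are those with at most `(i+1)/2` elements in an exceptional set `C`, and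
this bound stops being a restriction at position `2k` (`exists_extension_bound`,
`exists_bound_subset_family`).

To keep everything Borel, the families of admissible sets are computed forwards along the paths and
the colours are then chosen backwards (`exists_measurable_choice`). Both passes are instances of
`exists_measurable_greedy`. -/

open MeasureTheory

/-! ### Borel tools: enumerations, countable colourings, recursion. -/

/-- The neighbours in a Borel `d`-regular graph are enumerated by `d` Borel maps. -/
theorem exists_measurable_neighbor_enum {d : ℕ} {V : Type*} [MeasurableSpace V]
    [StandardBorelSpace V] (G : SimpleGraph V) [G.LocallyFinite] (hBorel : IsBorelGraph G)
    (hreg : G.IsRegularOfDegree d) :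
    ∃ e : Fin d → V → V, (∀ i, Measurable (e i)) ∧ (∀ x, Function.Injective fun i => e i x) ∧
      ∀ x y, G.Adj x y ↔ ∃ i, e i x = y := by
  classical
  have hφ := measurableEmbedding_embeddingReal V
  set φ := embeddingReal V
  have hcard : ∀ x, ((G.neighborFinset x).image φ).card = d := fun x => by
    rw [Finset.card_image_of_injective _ hφ.injective]; exact hreg x
  have hex : ∀ x i, ∃ y, G.Adj x y ∧ φ y = ((G.neighborFinset x).image φ).orderEmbOfFin (hcard x) i := by
    intro x i
    obtain ⟨y, hy, hyx⟩ := Finset.mem_image.1 (Finset.orderEmbOfFin_mem _ (hcard x) i)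
    exact ⟨y, (G.mem_neighborFinset x y).1 hy, hyx⟩
  choose e he using hex
  have hrange : ∀ x y, G.Adj x y ↔ ∃ i, e x i = y := by
    intro x y
    refine ⟨fun h => ?_, fun ⟨i, hi⟩ => hi ▸ (he x i).1⟩
    have hm : φ y ∈ Set.range (((G.neighborFinset x).image φ).orderEmbOfFin (hcard x)) := by
      rw [Finset.range_orderEmbOfFin]
      simpa using ⟨y, h, rfl⟩
    obtain ⟨i, hi⟩ := hm
    exact ⟨i, hφ.injective ((he x i).2.trans hi)⟩
  -- `E` is the graph of `x ↦ e x`, described by Borel conditions. Each `e i` is then Borel by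
  -- Lusin–Souslin, since the first projection is injective on `E`.
  let E : Set (V × (Fin d → V)) :=
    {p | (∀ i, G.Adj p.1 (p.2 i)) ∧ ∀ i j, i < j → φ (p.2 i) < φ (p.2 j)}
  have hE : MeasurableSet E := by
    have h1 : ∀ i : Fin d, MeasurableSet {p : V × (Fin d → V) | G.Adj p.1 (p.2 i)} := fun i =>
      MeasurableSet.preimage (t := {p : V × V | G.Adj p.1 p.2}) hBorel
        (measurable_fst.prodMk ((measurable_pi_apply i).comp measurable_snd))
    have h2 : ∀ i j : Fin d, i < j → MeasurableSet {p : V × (Fin d → V) | φ (p.2 i) < φ (p.2 j)} :=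
      fun i j _ => measurableSet_lt
        (hφ.measurable.comp ((measurable_pi_apply i).comp measurable_snd))
        (hφ.measurable.comp ((measurable_pi_apply j).comp measurable_snd))
    have : E = (⋂ i : Fin d, {p : V × (Fin d → V) | G.Adj p.1 (p.2 i)}) ∩
        ⋂ i : Fin d, ⋂ j : Fin d, ⋂ _ : i < j, {p : V × (Fin d → V) | φ (p.2 i) < φ (p.2 j)} := by
      ext p; simp [E]
    rw [this]
    exact (MeasurableSet.iInter h1).inter
      (MeasurableSet.iInter fun i => MeasurableSet.iInter fun j => MeasurableSet.iInter (h2 i j))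
  have hmem : ∀ x, (x, e x) ∈ E := fun x =>
    ⟨fun i => (he x i).1, fun i j hij => by
      rw [(he x i).2, (he x j).2]
      exact (Finset.orderEmbOfFin _ _).strictMono hij⟩
  have huniq : ∀ p ∈ E, p.2 = e p.1 := by
    rintro ⟨x, u⟩ ⟨h1, h2⟩
    have := Finset.orderEmbOfFin_unique (hcard x) (f := fun i => φ (u i))
      (fun i => by simpa using ⟨u i, h1 i, rfl⟩) (fun i j hij => h2 i j hij)
    funext i
    exact hφ.injective ((congrFun this i).trans (he x i).2.symm)
  have hinj : Set.InjOn Prod.fst E := by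
    intro p hp q hq h
    exact Prod.ext h (by rw [huniq p hp, huniq q hq, h])
  have hei : ∀ x, Function.Injective (e x) := fun x i j hij =>
    (Finset.orderEmbOfFin _ (hcard x)).injective <| by rw [← (he x i).2, ← (he x j).2, hij]
  refine ⟨fun i x => e x i, fun i A hA => ?_, hei, hrange⟩
  have : (fun x => e x i) ⁻¹' A = Prod.fst '' (E ∩ {p | p.2 i ∈ A}) := by
    ext x
    constructor
    · intro hx
      exact ⟨(x, e x), ⟨hmem x, hx⟩, rfl⟩
    · rintro ⟨p, ⟨hp, hpA⟩, rfl⟩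
      have h := huniq p hp
      simp only [Set.mem_preimage]
      rw [← h]; exact hpA
  rw [this]
  exact (hE.inter (((measurable_pi_apply i).comp measurable_snd) hA)).image_of_measurable_injOn
    measurable_fst (hinj.mono Set.inter_subset_left)

/-- Finitely many Borel self-maps admit a countable Borel colouring in which every point differs
in colour from its distinct images. -/
theorem exists_measurable_nat_coloring {V ι : Type*} [MeasurableSpace V] [StandardBorelSpace V]
    [Finite ι] (g : ι → V → V) (hg : ∀ i, Measurable (g i)) :
    ∃ c : V → ℕ, Measurable c ∧ ∀ x i, g i x ≠ x → c (g i x) ≠ c x := by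
  classical
  have hφ := measurableEmbedding_embeddingReal V
  set φ := embeddingReal V
  -- At a fine enough scale `n`, the floors of `n * φ` separate `x` from its finitely many distinct
  -- images. The colour records the least such `n` together with the floor at `x`; equal colours
  -- would mean equal scales and equal floors.
  let p : V → ℕ → Prop := fun x n => ∀ i, g i x = x ∨ ⌊(n : ℝ) * φ (g i x)⌋ ≠ ⌊(n : ℝ) * φ x⌋
  have hp : ∀ x, ∃ n, p x n := by
    intro x
    have : ∀ i, ∀ᶠ n : ℕ in Filter.atTop,
        g i x = x ∨ ⌊(n : ℝ) * φ (g i x)⌋ ≠ ⌊(n : ℝ) * φ x⌋ := by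
      intro i
      by_cases h : g i x = x
      · simp [h]
      have hpos : 0 < |φ (g i x) - φ x| := abs_pos.2 (sub_ne_zero.2 (hφ.injective.ne h))
      obtain ⟨N, hN⟩ := exists_nat_gt (1 / |φ (g i x) - φ x|)
      filter_upwards [Filter.eventually_ge_atTop N] with n hn
      refine Or.inr fun hfl => ?_
      have h1 := Int.abs_sub_lt_one_of_floor_eq_floor hfl
      rw [← mul_sub, abs_mul, Nat.abs_cast] at h1
      have h2 : 1 < (N : ℝ) * |φ (g i x) - φ x| := (div_lt_iff₀ hpos).1 hN
      have h3 : (N : ℝ) ≤ n := by exact_mod_cast hn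
      nlinarith
    exact (Filter.eventually_all.2 this).exists
  have hfloor : ∀ n : ℕ, ∀ h : V → V, Measurable h → Measurable fun x => ⌊(n : ℝ) * φ (h x)⌋ :=
    fun n h hh => ((hφ.measurable.comp hh).const_mul _).floor
  have hpm : ∀ n, MeasurableSet {x | p x n} := by
    intro n
    have : {x | p x n} = ⋂ i, ({x | g i x = x} ∪
        {x | ⌊(n : ℝ) * φ (g i x)⌋ = ⌊(n : ℝ) * φ x⌋}ᶜ) := by
      ext x; simp [p]
    rw [this]
    exact MeasurableSet.iInter fun i => (measurableSet_eq_fun (hg i) measurable_id).union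
      (measurableSet_eq_fun (hfloor n _ (hg i)) (hfloor n _ measurable_id)).compl
  have hN := measurable_find hp hpm
  have hpair : Measurable fun x => (Nat.find (hp x), ⌊(Nat.find (hp x) : ℝ) * φ x⌋) :=
    hN.prodMk (((measurable_from_nat.comp hN).mul hφ.measurable).floor)
  refine ⟨fun x => Encodable.encode (Nat.find (hp x), ⌊(Nat.find (hp x) : ℝ) * φ x⌋),
    (measurable_of_countable Encodable.encode).comp hpair, ?_⟩
  intro x i hne hc
  have := Prod.ext_iff.1 (Encodable.encode_injective hc)
  obtain ⟨h1, h2⟩ := this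
  simp only at h1 h2
  rw [h1] at h2
  exact (Nat.find_spec (hp x) i).elim hne fun h => h h2

/-- Borel recursion along a countable well-founded rank: the value at a point is computed by a Borel
rule from the values at those of its finitely many Borel images which have lower rank. -/
theorem exists_measurable_greedy {V Q ι K : Type*} [MeasurableSpace V] [LT Q] [WellFoundedLT Q]
    [DecidableLT Q] [Countable Q] [Finite ι] [Finite K]
    (ρ : V → Q) (hρ : ∀ q, MeasurableSet (ρ ⁻¹' {q}))
    (g : ι → V → V) (hg : ∀ i, Measurable (g i))
    (Φ : V → (ι → Option K) → K) (hΦ : ∀ σ a, MeasurableSet {x | Φ x σ = a}) :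
    ∃ F : V → K, (∀ a, MeasurableSet (F ⁻¹' {a})) ∧
      ∀ x, F x = Φ x fun i => if ρ (g i x) < ρ x then some (F (g i x)) else none := by
  classical
  have hwf : WellFounded (InvImage (· < ·) ρ) := InvImage.wf ρ wellFounded_lt
  let F : V → K := hwf.fix fun x rec =>
    Φ x fun i => if h : ρ (g i x) < ρ x then some (rec (g i x) h) else none
  have hF : ∀ x, F x = Φ x fun i => if ρ (g i x) < ρ x then some (F (g i x)) else none := by
    intro x
    have := hwf.fix_eq (fun x (rec : ∀ y, InvImage (· < ·) ρ y x → K) =>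
      Φ x fun i => if h : ρ (g i x) < ρ x then some (rec (g i x) h) else none) x
    simp only [dite_eq_ite] at this
    exact this
  refine ⟨F, ?_, hF⟩
  have key : ∀ q a, MeasurableSet (ρ ⁻¹' {q} ∩ F ⁻¹' {a}) := by
    intro q
    induction q using WellFoundedLT.induction with
    | ind q ih =>
    intro a
    -- For `x` of rank `q`, `C i o` says that the `i`-th input of the rule is `o`. It involves `F`
    -- only at ranks below `q`, where measurability is known by induction.
    let C : ι → Option K → Set V := fun i o =>
      o.elim ((⋃ r : {r // r < q}, g i ⁻¹' (ρ ⁻¹' {r.1}))ᶜ)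
        fun b => ⋃ r : {r // r < q}, g i ⁻¹' (ρ ⁻¹' {r.1} ∩ F ⁻¹' {b})
    have hC : ∀ i o, MeasurableSet (C i o) := by
      rintro i (_ | b)
      · exact (MeasurableSet.iUnion fun r : {r // r < q} => hg i (hρ r.1)).compl
      · exact MeasurableSet.iUnion fun r : {r // r < q} => hg i (ih r.1 r.2 b)
    have hCmem : ∀ x, ρ x = q → ∀ i o,
        x ∈ C i o ↔ (if ρ (g i x) < ρ x then some (F (g i x)) else none) = o := by
      rintro x rfl i (_ | b)
      · simpa [C] using ⟨fun h hlt => h _ hlt rfl, fun h a ha e => h (e ▸ ha)⟩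
      · simp [C]
    have : ρ ⁻¹' {q} ∩ F ⁻¹' {a} =
        ρ ⁻¹' {q} ∩ ⋃ σ : ι → Option K, {x | Φ x σ = a} ∩ ⋂ i, C i (σ i) := by
      ext x
      simp only [Set.mem_inter_iff, Set.mem_preimage, Set.mem_singleton_iff, Set.mem_iUnion,
        Set.mem_iInter, and_congr_right_iff]
      intro hx
      simp only [hCmem x hx]
      constructor
      · intro h
        exact ⟨_, (hF x).symm.trans h, fun i => rfl⟩
      · rintro ⟨σ, h1, h2⟩
        rw [hF x, funext h2]; exact h1
    rw [this]
    exact (hρ q).inter (MeasurableSet.iUnion fun σ =>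
      (hΦ σ a).inter (MeasurableSet.iInter fun i => hC i (σ i)))
  intro a
  have : F ⁻¹' {a} = ⋃ q, ρ ⁻¹' {q} ∩ F ⁻¹' {a} := by
    ext x; simp
  rw [this]
  exact MeasurableSet.iUnion fun q => key q a

/-! ### Combinatorics of `k`-sets chosen along a path. -/

/-- One step of list colouring along a path, with `k`-sets chosen from lists of size `2k+1`: the
family of sets which extend to a disjoint member of a family of sets having at most `(i+1)/2`
elements in `C`. -/
theorem exists_extension_bound {α : Type*} [DecidableEq α] {k i : ℕ} {L C L' : Finset α}
    (hCL : C ⊆ L) (hL : L.card = 2 * k + 1) (hC : C.card = k + i % 2)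
    (hL' : L'.card = 2 * k + 1) :
    ∃ C' ⊆ L', C'.card = k + (i + 1) % 2 ∧ ∀ Y ⊆ L', Y.card = k →
      2 * (Y ∩ C').card ≤ i + 2 →
      ∃ Z ⊆ L, Z.card = k ∧ 2 * (Z ∩ C).card ≤ i + 1 ∧ Disjoint Y Z := by
  have hB : (L \ C).card = k + (i + 1) % 2 := by
    rw [Finset.card_sdiff_of_subset hCL]; omega
  -- `C'` contains the part of `L \ C` that lies in `L'`, so a `Y` with few elements in `C'` blocks
  -- few elements of `L \ C`, which is where `Z` should be chosen.
  obtain ⟨C', h1, h2, h3⟩ := Finset.exists_subsuperset_card_eq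
    (s := (L \ C) ∩ L') (t := L') (n := k + (i + 1) % 2) Finset.inter_subset_right
    ((Finset.card_le_card Finset.inter_subset_left).trans hB.le) (by omega)
  refine ⟨C', h2, h3, fun Y hY hYk hYC => ?_⟩
  have hBY : ((L \ C) ∩ Y).card ≤ (Y ∩ C').card := Finset.card_le_card fun a ha => by
    simp only [Finset.mem_inter] at ha ⊢
    exact ⟨ha.2, h1 (Finset.mem_inter.2 ⟨ha.1, hY ha.2⟩)⟩
  have hB2 := Finset.card_sdiff_add_card_inter (L \ C) Y
  have hL2 := Finset.card_sdiff_add_card_inter L Y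
  have hL3 : (L ∩ Y).card ≤ k := hYk ▸ Finset.card_le_card Finset.inter_subset_right
  by_cases hk : k ≤ ((L \ C) \ Y).card
  · obtain ⟨Z, hZ, hZk⟩ := Finset.exists_subset_card_eq hk
    refine ⟨Z, fun a ha => ?_, hZk, ?_, ?_⟩
    · have := hZ ha; simp only [Finset.mem_sdiff] at this; exact this.1.1
    · have : Z ∩ C = ∅ := by
        ext a
        simp only [Finset.mem_inter, Finset.notMem_empty, iff_false, not_and]
        intro ha; have := hZ ha; simp only [Finset.mem_sdiff] at this; exact this.1.2
      simp [this]
    · rw [Finset.disjoint_right]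
      intro a ha; have := hZ ha; simp only [Finset.mem_sdiff] at this; exact this.2
  -- `Z` uses all of `(L \ C) \ Y`, so `|Z ∩ C|` is at most `k - |L \ C| + |Y ∩ C'|`. For even `i`,
  -- `L \ C` has `k+1` elements and this gains one; for odd `i` rounding down `(i+2)/2` suffices.
  · obtain ⟨Z, hZ1, hZ2, hZk⟩ := Finset.exists_subsuperset_card_eq
      (s := (L \ C) \ Y) (t := L \ Y) (n := k)
      (Finset.sdiff_subset_sdiff Finset.sdiff_subset le_rfl) (by omega) (by omega)
    refine ⟨Z, hZ2.trans Finset.sdiff_subset, hZk, ?_, ?_⟩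
    · have h4 : Z ∩ C ⊆ Z \ ((L \ C) \ Y) := fun a ha => by
        simp only [Finset.mem_inter, Finset.mem_sdiff] at ha ⊢
        exact ⟨ha.1, fun h => h.1.2 ha.2⟩
      have h5 := Finset.card_le_card h4
      rw [Finset.card_sdiff_of_subset hZ1] at h5
      omega
    · exact (Finset.disjoint_sdiff).mono_right hZ2

/-! ### Borel discrete sets and nonbacktracking rays. -/

/-- Balls of radius `n` become finite families of Borel images, so that quantifying over a ball
preserves Borel sets. -/
theorem exists_measurable_walk_enum {d : ℕ} {V : Type*} [MeasurableSpace V] {G : SimpleGraph V}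
    {e : Fin d → V → V} (he : ∀ i, Measurable (e i)) (hadj : ∀ x y, G.Adj x y ↔ ∃ i, e i x = y)
    (n : ℕ) :
    ∃ (ι : Type) (_ : Finite ι) (g : ι → V → V), (∀ i, Measurable (g i)) ∧
      ∀ x y, (∃ p : G.Walk x y, p.length ≤ n) ↔ ∃ i, g i x = y := by
  induction n with
  | zero =>
    refine ⟨Unit, inferInstance, fun _ => id, fun _ => measurable_id, fun x y => ?_⟩
    constructor
    · rintro ⟨p, hp⟩
      exact ⟨(), SimpleGraph.Walk.eq_of_length_eq_zero (Nat.le_zero.1 hp)⟩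
    · rintro ⟨_, rfl⟩
      exact ⟨.nil, le_rfl⟩
  | succ n ih =>
    obtain ⟨ι, _, g, hg, hgw⟩ := ih
    refine ⟨Option (Fin d × ι), inferInstance,
      fun o => o.elim id fun q => g q.2 ∘ e q.1, ?_, fun x y => ?_⟩
    · rintro (_ | q)
      · exact measurable_id
      · exact (hg _).comp (he _)
    constructor
    · rintro ⟨p, hp⟩
      cases p with
      | nil => exact ⟨none, rfl⟩
      | cons h q =>
        obtain ⟨j, rfl⟩ := (hadj _ _).1 h
        obtain ⟨i, hi⟩ := (hgw _ _).1 ⟨q, by simpa using hp⟩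
        exact ⟨some (j, i), hi⟩
    · rintro ⟨_ | ⟨j, i⟩, h⟩
      · obtain rfl : x = y := h
        exact ⟨.nil, Nat.zero_le _⟩
      · obtain ⟨q, hq⟩ := (hgw (e j x) y).2 ⟨i, h⟩
        exact ⟨.cons ((hadj _ _).2 ⟨j, rfl⟩) q, by simpa using hq⟩

/-- A Borel graph of finite degree has a Borel maximal set whose points are at distance more than
`n` from each other. -/
theorem exists_measurable_maximal_discrete {d : ℕ} {V : Type*} [MeasurableSpace V]
    [StandardBorelSpace V] {G : SimpleGraph V} {e : Fin d → V → V}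
    (he : ∀ i, Measurable (e i)) (hadj : ∀ x y, G.Adj x y ↔ ∃ i, e i x = y) (n : ℕ) :
    ∃ S : Set V, MeasurableSet S ∧
      (∀ x ∈ S, ∀ y ∈ S, ∀ p : G.Walk x y, p.length ≤ n → x = y) ∧
      ∀ x, ∃ y ∈ S, ∃ p : G.Walk x y, p.length ≤ n := by
  classical
  obtain ⟨ι, _, g, hg, hgw⟩ := exists_measurable_walk_enum he hadj n
  obtain ⟨c, hc, hcol⟩ := exists_measurable_nat_coloring g hg
  -- A point is selected exactly when no point of smaller colour in its `n`-ball is selected.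
  -- Distinct points at distance at most `n` have distinct colours, so one of the two is decided
  -- before the other.
  obtain ⟨F, hFm, hF⟩ := exists_measurable_greedy c (fun q => hc (measurableSet_singleton q)) g hg
    (fun _ σ => decide (∀ i, σ i ≠ some true)) (fun σ a => MeasurableSet.const _)
  have hF' : ∀ x, F x = true ↔ ∀ i, c (g i x) < c x → F (g i x) ≠ true := fun x => by
    rw [hF x]; simp
  refine ⟨F ⁻¹' {true}, hFm _, ?_, fun x => ?_⟩
  · have aux : ∀ x y, F x = true → F y = true → ∀ p : G.Walk x y, p.length ≤ n →
        ¬ c y < c x := by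
      intro x y hx hy p hp hlt
      obtain ⟨i, rfl⟩ := (hgw x y).1 ⟨p, hp⟩
      exact (hF' x).1 hx i hlt hy
    intro x hx y hy p hp
    by_contra hne
    obtain ⟨i, hi⟩ := (hgw x y).1 ⟨p, hp⟩
    have hne' := hcol x i (by rw [hi]; exact fun h => hne h.symm)
    rw [hi] at hne'
    rcases lt_or_gt_of_ne hne' with h | h
    · exact aux x y hx hy p hp h
    · exact aux y x hy hx p.reverse (by simpa using hp) h
  · by_cases hx : F x = true
    · exact ⟨x, hx, .nil, Nat.zero_le _⟩
    · rw [hF' x] at hx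
      push Not at hx
      obtain ⟨i, -, hi⟩ := hx
      exact ⟨g i x, hi, (hgw _ _).2 ⟨i, rfl⟩⟩

/-- From every vertex of a graph with at least two neighbours everywhere starts a nonbacktracking
ray which depends on it in a Borel way. -/
theorem exists_measurable_nonbacktracking {d : ℕ} (hd : 2 ≤ d) {V : Type*} [MeasurableSpace V]
    [StandardBorelSpace V] {G : SimpleGraph V} {e : Fin d → V → V}
    (he : ∀ i, Measurable (e i)) (hinj : ∀ x, Function.Injective fun i => e i x)
    (hadj : ∀ x y, G.Adj x y ↔ ∃ i, e i x = y) :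
    ∃ a : ℕ → V → V, (∀ i, Measurable (a i)) ∧ (∀ s, a 0 s = s) ∧
      (∀ s i, G.Adj (a i s) (a (i + 1) s)) ∧ ∀ s i, a i s ≠ a (i + 2) s := by
  classical
  let z : Fin d := ⟨0, by omega⟩
  let o : Fin d := ⟨1, by omega⟩
  have hzo : ∀ x, e z x ≠ e o x := fun x h => by simpa [z, o] using hinj x h
  -- The state is a directed edge (previous vertex, current vertex). Of the two neighbours given by
  -- `z` and `o`, at most one is the previous vertex.
  let step : V × V → V × V := fun p => (p.2, if e z p.2 = p.1 then e o p.2 else e z p.2)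
  have hstep : Measurable step := measurable_snd.prodMk
    (Measurable.ite (measurableSet_eq_fun ((he z).comp measurable_snd) measurable_fst)
      ((he o).comp measurable_snd) ((he z).comp measurable_snd))
  let b : ℕ → V → V × V := fun i s => step^[i] (s, e z s)
  have hb : ∀ i s, b (i + 1) s = step (b i s) := fun i s => Function.iterate_succ_apply' _ _ _
  have hba : ∀ i s, G.Adj (b i s).1 (b i s).2 := by
    intro i s
    cases i with
    | zero => exact (hadj _ _).2 ⟨z, rfl⟩
    | succ i =>
      rw [hb]
      refine (hadj _ _).2 ?_
      by_cases h : e z (b i s).2 = (b i s).1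
      · exact ⟨o, by simp [step, h]⟩
      · exact ⟨z, by simp [step, h]⟩
  refine ⟨fun i s => (b i s).1, fun i => measurable_fst.comp ((hstep.iterate i).comp
    (measurable_id.prodMk (he z))), fun s => rfl, fun s i => ?_, fun s i => ?_⟩
  · simpa only [hb] using hba i s
  · simp only [hb, step]
    split_ifs with h
    · rw [← h]; exact hzo _
    · exact fun h' => h h'.symm

/-- In a forest a walk whose consecutive edges differ is a path; the condition on the first edge
carries the induction. -/
theorem SimpleGraph.IsAcyclic.exists_isPath_of_nonbacktracking {V : Type*} {G : SimpleGraph V}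
    (hG : G.IsAcyclic) {u : ℕ → V} (hu : ∀ i, G.Adj (u i) (u (i + 1)))
    (hu2 : ∀ i, u i ≠ u (i + 2)) (i n : ℕ) :
    ∃ p : G.Walk (u i) (u (i + n)), p.IsPath ∧ p.length = n := by
  have key : ∀ n i, ∃ p : G.Walk (u i) (u (i + n)), p.length = n ∧
      p.edges.IsChain (· ≠ ·) ∧ ∀ y ∈ p.edges.head?, y = s(u i, u (i + 1)) := by
    intro n
    induction n with
    | zero => exact fun i => ⟨.nil, by simp⟩
    | succ n ih =>
      intro i
      have := ih (i + 1)
      rw [show i + 1 + n = i + (n + 1) by omega] at this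
      obtain ⟨q, hq1, hq2, hq3⟩ := this
      refine ⟨.cons (hu i) q, by simp [hq1], ?_, ?_⟩
      · rw [SimpleGraph.Walk.edges_cons, List.isChain_cons]
        refine ⟨fun y hy => ?_, hq2⟩
        rw [hq3 y hy, Ne, Sym2.eq_iff]
        rintro (⟨h, -⟩ | ⟨h, -⟩)
        · exact (hu i).ne h
        · exact hu2 i h
      · simp
  obtain ⟨p, h1, h2, -⟩ := key n i
  exact ⟨p, (hG.isPath_iff_isChain p).2 h2, h1⟩

theorem SimpleGraph.IsAcyclic.injective_of_nonbacktracking {V : Type*} {G : SimpleGraph V}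
    (hG : G.IsAcyclic) {u : ℕ → V} (hu : ∀ i, G.Adj (u i) (u (i + 1)))
    (hu2 : ∀ i, u i ≠ u (i + 2)) : Function.Injective u := by
  have closed : ∀ {x y} (p : G.Walk x y), p.IsPath → x = y → p.length = 0 := by
    rintro x y p hp rfl
    exact SimpleGraph.Walk.length_eq_zero_iff.2 (SimpleGraph.Walk.isPath_iff_nil.1 hp)
  intro i j hij
  wlog h : i ≤ j generalizing i j
  · exact (this hij.symm (le_of_not_ge h)).symm
  obtain ⟨n, rfl⟩ := Nat.exists_eq_add_of_le h
  obtain ⟨p, hp, hn⟩ := hG.exists_isPath_of_nonbacktracking hu hu2 i n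
  have := closed p hp hij
  omega

/-- Paths in a forest are unique, so the segment of the ray between two adjacent vertices is a
single edge. -/
theorem SimpleGraph.IsAcyclic.eq_succ_of_adj_of_nonbacktracking {V : Type*} {G : SimpleGraph V}
    (hG : G.IsAcyclic) {u : ℕ → V} (hu : ∀ i, G.Adj (u i) (u (i + 1)))
    (hu2 : ∀ i, u i ≠ u (i + 2)) {i j : ℕ} (h : G.Adj (u i) (u j)) :
    j = i + 1 ∨ i = j + 1 := by
  wlog hle : i ≤ j generalizing i j
  · exact (this h.symm (le_of_not_ge hle)).symm
  obtain ⟨n, rfl⟩ := Nat.exists_eq_add_of_le hle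
  obtain ⟨p, hp, hn⟩ := hG.exists_isPath_of_nonbacktracking hu hu2 i n
  have := congrArg (fun q : G.Path _ _ => q.1.length)
    ((hG.subsingleton_path _ _).elim ⟨p, hp⟩ (SimpleGraph.Path.singleton h))
  simp [SimpleGraph.Path.singleton] at this
  omega

/-! ### Layout of the paths. -/

/-- A Borel set `{lev = 0}` at bounded distance from every vertex, whose connected components are
induced paths with `m` edges. Along these paths, `idx` is the position; elsewhere `idx` is a
countable proper colouring and `lev` decreases towards the set. -/
structure PathLayout {V : Type*} [MeasurableSpace V] (G : SimpleGraph V) (m : ℕ) where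
  lev : V → ℕ
  idx : V → ℕ
  bound : ℕ
  measurable_lev : Measurable lev
  measurable_idx : Measurable idx
  lev_le : ∀ x, lev x ≤ bound
  exists_lev_lt : ∀ x, lev x ≠ 0 → ∃ y, G.Adj x y ∧ lev y < lev x
  idx_ne : ∀ x y, G.Adj x y → lev x ≠ 0 → lev y ≠ 0 → idx x ≠ idx y
  idx_le : ∀ x, lev x = 0 → idx x ≤ m
  idx_adj : ∀ x y, G.Adj x y → lev x = 0 → lev y = 0 → idx y = idx x + 1 ∨ idx x = idx y + 1
  exists_succ : ∀ x, lev x = 0 → idx x < m → ∃ y, G.Adj x y ∧ lev y = 0 ∧ idx y = idx x + 1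
  exists_pred : ∀ x, lev x = 0 → idx x ≠ 0 → ∃ y, G.Adj x y ∧ lev y = 0 ∧ idx x = idx y + 1
  eq_of_idx_eq : ∀ x y z, G.Adj x y → G.Adj x z → lev x = 0 → lev y = 0 → lev z = 0 →
    idx y = idx z → y = z

theorem nonempty_pathLayout {d : ℕ} (hd : 2 ≤ d) {V : Type*} [MeasurableSpace V]
    [StandardBorelSpace V] {G : SimpleGraph V} (hG : G.IsAcyclic) {e : Fin d → V → V}
    (he : ∀ i, Measurable (e i)) (hinj : ∀ x, Function.Injective fun i => e i x)
    (hadj : ∀ x y, G.Adj x y ↔ ∃ i, e i x = y) (m : ℕ) : Nonempty (PathLayout G m) := by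
  classical
  -- If paths with `m` edges from two points of `S` meet or are joined by an edge, their starting
  -- points are at distance at most `m + 1 + m`.
  obtain ⟨S, hS, hdisc, hmax⟩ := exists_measurable_maximal_discrete he hadj (2 * m + 1)
  obtain ⟨a, ha, ha0, haadj, hanb⟩ := exists_measurable_nonbacktracking hd he hinj hadj
  obtain ⟨c, hc, hcol⟩ := exists_measurable_nat_coloring e he
  have hwalk : ∀ s i, ∃ p : G.Walk s (a i s), p.length = i := by
    intro s i
    obtain ⟨p, -, hp⟩ := hG.exists_isPath_of_nonbacktracking (haadj s) (hanb s) 0 i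
    exact ⟨p.copy (ha0 s) (by rw [Nat.zero_add]), by simpa using hp⟩
  have hsame : ∀ s ∈ S, ∀ s' ∈ S, ∀ i ≤ m, ∀ j ≤ m, ∀ q : G.Walk (a i s) (a j s'),
      q.length ≤ 1 → s = s' := by
    intro s hs s' hs' i hi j hj q hq
    obtain ⟨p, hp⟩ := hwalk s i
    obtain ⟨p', hp'⟩ := hwalk s' j
    refine hdisc s hs s' hs' (p.append (q.append p'.reverse)) ?_
    simp only [SimpleGraph.Walk.length_append, SimpleGraph.Walk.length_reverse]
    omega
  have heq : ∀ s ∈ S, ∀ s' ∈ S, ∀ i ≤ m, ∀ j ≤ m, a i s = a j s' → s = s' ∧ i = j := by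
    intro s hs s' hs' i hi j hj h
    obtain rfl := hsame s hs s' hs' i hi j hj (SimpleGraph.Walk.nil.copy rfl h) (by simp)
    exact ⟨rfl, hG.injective_of_nonbacktracking (haadj s) (hanb s) h⟩
  have hedge : ∀ s ∈ S, ∀ s' ∈ S, ∀ i ≤ m, ∀ j ≤ m, G.Adj (a i s) (a j s') →
      s = s' ∧ (j = i + 1 ∨ i = j + 1) := by
    intro s hs s' hs' i hi j hj h
    obtain rfl := hsame s hs s' hs' i hi j hj h.toWalk (by simp)
    exact ⟨rfl, hG.eq_succ_of_adj_of_nonbacktracking (haadj s) (hanb s) h⟩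
  let T : ℕ → Set V := fun i => {x | i ≤ m ∧ x ∈ a i '' S}
  have hT : ∀ i, MeasurableSet (T i) := by
    intro i
    by_cases hi : i ≤ m
    · have : T i = a i '' S := by ext x; simp [T, hi]
      rw [this]
      exact hS.image_of_measurable_injOn (ha i)
        fun s hs s' hs' h => (heq s hs s' hs' i hi i hi h).1
    · have : T i = ∅ := by ext x; simp [T, hi]
      rw [this]; exact MeasurableSet.empty
  let P : Set V := ⋃ i, T i
  have hP : MeasurableSet P := MeasurableSet.iUnion hT
  have hmemP : ∀ x, x ∈ P ↔ ∃ i, x ∈ T i := fun x => Set.mem_iUnion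
  -- Exactly one `n` satisfies `pI x n`, by disjointness of the paths; `Nat.find` only serves to
  -- make the index a Borel function.
  let pI : V → ℕ → Prop := fun x n => x ∈ T n ∨ (x ∉ P ∧ c x = n)
  have hpI : ∀ x, ∃ n, pI x n := by
    intro x
    by_cases hx : x ∈ P
    · obtain ⟨i, hi⟩ := (hmemP x).1 hx
      exact ⟨i, Or.inl hi⟩
    · exact ⟨c x, Or.inr ⟨hx, rfl⟩⟩
  have hpIm : ∀ n, MeasurableSet {x | pI x n} := fun n =>
    (hT n).union (hP.compl.inter (hc (measurableSet_singleton n)))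
  let pL : V → ℕ → Prop := fun x n => ∃ y ∈ P, ∃ p : G.Walk x y, p.length ≤ n
  have hSP : ∀ s ∈ S, s ∈ P := fun s hs =>
    (hmemP s).2 ⟨0, Nat.zero_le _, s, hs, ha0 s⟩
  have hpLN : ∀ x, pL x (2 * m + 1) := fun x => by
    obtain ⟨y, hy, p, hp⟩ := hmax x
    exact ⟨y, hSP y hy, p, hp⟩
  have hpL : ∀ x, ∃ n, pL x n := fun x => ⟨_, hpLN x⟩
  have hpLm : ∀ n, MeasurableSet {x | pL x n} := by
    intro n
    obtain ⟨ι, _, g, hg, hgw⟩ := exists_measurable_walk_enum he hadj n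
    have : {x | pL x n} = ⋃ i, g i ⁻¹' P := by
      ext x
      simp only [pL, hgw, Set.mem_ofPred_eq, Set.mem_iUnion, Set.mem_preimage]
      constructor
      · rintro ⟨y, hy, i, rfl⟩
        exact ⟨i, hy⟩
      · rintro ⟨i, hi⟩
        exact ⟨_, hi, i, rfl⟩
    rw [this]
    exact MeasurableSet.iUnion fun i => hg i hP
  let lev : V → ℕ := fun x => Nat.find (hpL x)
  let idx : V → ℕ := fun x => Nat.find (hpI x)
  have hlev0 : ∀ x, lev x = 0 ↔ x ∈ P := by
    intro x
    rw [Nat.find_eq_zero]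
    constructor
    · rintro ⟨y, hy, p, hp⟩
      rwa [SimpleGraph.Walk.eq_of_length_eq_zero (Nat.le_zero.1 hp)]
    · exact fun hx => ⟨x, hx, .nil, le_rfl⟩
  have hidxP : ∀ s ∈ S, ∀ i ≤ m, lev (a i s) = 0 ∧ idx (a i s) = i := by
    intro s hs i hi
    have hx : a i s ∈ P := (hmemP _).2 ⟨i, hi, s, hs, rfl⟩
    refine ⟨(hlev0 _).2 hx, ?_⟩
    rcases Nat.find_spec (hpI (a i s)) with ⟨h1, s', hs', h2⟩ | h
    · exact (heq s' hs' s hs _ h1 i hi h2).2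
    · exact absurd hx h.1
  have hrep : ∀ x, lev x = 0 → ∃ s ∈ S, ∃ i ≤ m, a i s = x := by
    intro x hx
    obtain ⟨i, hi, s, hs, h⟩ := (hmemP x).1 ((hlev0 x).1 hx)
    exact ⟨s, hs, i, hi, h⟩
  have hidxc : ∀ x, lev x ≠ 0 → idx x = c x := by
    intro x hx
    rw [Ne, hlev0] at hx
    rcases Nat.find_spec (hpI x) with h | h
    · exact absurd ((hmemP x).2 ⟨_, h⟩) hx
    · exact h.2.symm
  refine ⟨⟨lev, idx, 2 * m + 1, measurable_find hpL hpLm, measurable_find hpI hpIm,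
    fun x => Nat.find_min' _ (hpLN x), ?_, ?_, ?_, ?_, ?_, ?_, ?_⟩⟩
  · intro x hx
    obtain ⟨y, hy, p, hp⟩ := Nat.find_spec (hpL x)
    change p.length ≤ lev x at hp
    cases p with
    | nil => exact absurd ((hlev0 x).2 hy) hx
    | @cons _ z _ h q =>
      refine ⟨z, h, ?_⟩
      have : lev z ≤ q.length := Nat.find_min' _ ⟨y, hy, q, le_rfl⟩
      rw [SimpleGraph.Walk.length_cons] at hp
      omega
  · intro x y h hx hy
    rw [hidxc x hx, hidxc y hy]
    obtain ⟨i, rfl⟩ := (hadj x y).1 h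
    exact (hcol x i h.ne').symm
  · intro x hx
    obtain ⟨s, hs, i, hi, rfl⟩ := hrep x hx
    rw [(hidxP s hs i hi).2]; exact hi
  · intro x y h hx hy
    obtain ⟨s, hs, i, hi, rfl⟩ := hrep x hx
    obtain ⟨s', hs', j, hj, rfl⟩ := hrep y hy
    rw [(hidxP s hs i hi).2, (hidxP s' hs' j hj).2]
    exact (hedge s hs s' hs' i hi j hj h).2
  · intro x hx hxm
    obtain ⟨s, hs, i, hi, rfl⟩ := hrep x hx
    rw [(hidxP s hs i hi).2] at hxm ⊢
    exact ⟨a (i + 1) s, haadj s i, hidxP s hs (i + 1) hxm⟩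
  · intro x hx hx0
    obtain ⟨s, hs, i, hi, rfl⟩ := hrep x hx
    rw [(hidxP s hs i hi).2] at hx0 ⊢
    obtain ⟨j, rfl⟩ := Nat.exists_eq_succ_of_ne_zero hx0
    obtain ⟨h1, h2⟩ := hidxP s hs j (by omega)
    exact ⟨a j s, (haadj s j).symm, h1, by rw [h2]⟩
  · intro x y z hxy hxz hx hy hz h
    obtain ⟨s, hs, i, hi, rfl⟩ := hrep x hx
    obtain ⟨s', hs', j, hj, rfl⟩ := hrep y hy
    obtain ⟨s'', hs'', l, hl, rfl⟩ := hrep z hz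
    obtain ⟨rfl, -⟩ := hedge s hs s' hs' i hi j hj hxy
    obtain ⟨rfl, -⟩ := hedge s hs s'' hs'' i hi l hl hxz
    rw [(hidxP s hs j hj).2, (hidxP s hs l hl).2] at h
    rw [h]

namespace PathLayout

variable {V : Type*} [MeasurableSpace V] {G : SimpleGraph V} {m : ℕ}

/-- The order in which colours, or families of admissible colours, are computed: far from the paths
first, then along the paths. -/
def Early (P : PathLayout G m) (y x : V) : Prop :=
  P.lev x < P.lev y ∨ P.lev x = P.lev y ∧ P.idx y < P.idx x

/-- Subtracting from `bound` reverses the order of levels, so that recursion can run along a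
countable well-founded order; by `lev_le` the truncation never occurs. -/
def rank (P : PathLayout G m) (x : V) : ℕ ×ₗ ℕ := toLex (P.bound - P.lev x, P.idx x)

theorem rank_lt_iff (P : PathLayout G m) (x y : V) : P.rank y < P.rank x ↔ P.Early y x := by
  have h1 := P.lev_le x
  have h2 := P.lev_le y
  simp only [rank, Prod.Lex.toLex_lt_toLex, Early]
  omega

theorem measurableSet_rank_preimage (P : PathLayout G m) (q : ℕ ×ₗ ℕ) :
    MeasurableSet (P.rank ⁻¹' {q}) := by
  have : P.rank ⁻¹' {q} =
      P.lev ⁻¹' {l | P.bound - l = (ofLex q).1} ∩ P.idx ⁻¹' {(ofLex q).2} := by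
    ext x
    simp only [Set.mem_preimage, Set.mem_singleton_iff, Set.mem_inter_iff, Set.mem_ofPred_eq, rank]
    rw [← toLex_ofLex q, toLex_inj, Prod.ext_iff]
    simp
  rw [this]
  exact (P.measurable_lev (Set.to_countable _).measurableSet).inter
    (P.measurable_idx (measurableSet_singleton _))

end PathLayout

/-! ### Forward pass: families of admissible colours. -/

instance kneserVertexFinite (n k : ℕ) : Finite (KneserVertex n k) :=
  inferInstanceAs (Finite {A : Finset (Fin n) // A.card = k})

theorem exists_kneserVertex_subset {n k : ℕ} {L : Finset (Fin n)} (h : k ≤ L.card) :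
    ∃ Y : KneserVertex n k, Y.1 ⊆ L :=
  let ⟨Y, hY, hk⟩ := Finset.exists_subset_card_eq h
  ⟨⟨Y, hk⟩, hY⟩

/-- The colours which remain after those of the `i ∈ I` have been used. -/
def freeColours {n k : ℕ} {ι : Type*} (h : ι → KneserVertex n k) (I : Finset ι) :
    Finset (Fin n) := (I.biUnion fun i => (h i).1)ᶜ

theorem subset_freeColours_iff {n k : ℕ} {ι : Type*} {h : ι → KneserVertex n k} {I : Finset ι}
    {Y : Finset (Fin n)} : Y ⊆ freeColours h I ↔ ∀ i ∈ I, Disjoint Y (h i).1 := by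
  rw [freeColours, Finset.subset_compl_iff_disjoint_right, Finset.disjoint_biUnion_right]

theorem le_card_freeColours {d k r : ℕ} {ι : Type*} (h : ι → KneserVertex (d * k + 1) k)
    (I : Finset ι) (hI : I.card + r ≤ d) : r * k + 1 ≤ (freeColours h I).card := by
  have h1 := Finset.card_biUnion_le_card_mul I (fun i => (h i).1) k fun i _ => (h i).2.le
  have h2 : (I.card + r) * k ≤ d * k := Nat.mul_le_mul_right k hI
  rw [freeColours, Finset.card_compl, Fintype.card_fin]
  rw [add_mul] at h2
  omega

/-- Borel families of admissible colours: one colour off the paths, and on the paths all colours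
which are compatible with admissible colours of the earlier neighbours. -/
theorem exists_measurable_family {d k : ℕ} (hd : d ≠ 0) {V : Type*} [MeasurableSpace V]
    {G : SimpleGraph V} {e : Fin d → V → V} (he : ∀ i, Measurable (e i))
    (hadj : ∀ x y, G.Adj x y ↔ ∃ i, e i x = y) {m : ℕ} (P : PathLayout G m) :
    ∃ (F : V → Set (KneserVertex (d * k + 1) k)) (col : V → KneserVertex (d * k + 1) k),
      (∀ A, MeasurableSet (F ⁻¹' {A})) ∧
      (∀ x, P.lev x ≠ 0 → F x = {col x}) ∧
      (∀ x, ∀ Y ∈ F x, ∀ y, G.Adj x y → P.Early y x → ∃ Z ∈ F y, Disjoint Y.1 Z.1) ∧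
      (∀ x, P.lev x = 0 → ∀ Y, (∀ y, G.Adj x y → P.Early y x → ∃ Z ∈ F y, Disjoint Y.1 Z.1) →
        Y ∈ F x) := by
  classical
  have hn : Nonempty (KneserVertex (d * k + 1) k) :=
    let ⟨Y, _⟩ := exists_kneserVertex_subset (n := d * k + 1) (k := k) (L := Finset.univ) (by
      rw [Finset.card_univ, Fintype.card_fin]
      exact (Nat.le_mul_of_pos_left k (Nat.pos_of_ne_zero hd)).trans (Nat.le_succ _))
    ⟨Y⟩
  let W := KneserVertex (d * k + 1) k
  let B : (Fin d → Option (Set W)) → Set W := fun σ =>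
    {Y | ∀ i A, σ i = some A → ∃ Z ∈ A, Disjoint Y.1 Z.1}
  -- Off the paths the family is a singleton, so a vertex next to such a point is constrained by an
  -- actual colour.
  let Φ : V → (Fin d → Option (Set W)) → Set W := fun x σ =>
    if P.lev x = 0 then B σ else {Classical.epsilon (· ∈ B σ)}
  have hΦ : ∀ σ A, MeasurableSet {x | Φ x σ = A} := by
    intro σ A
    have : {x | Φ x σ = A} = (P.lev ⁻¹' {0} ∩ {_x | B σ = A}) ∪
        ((P.lev ⁻¹' {0})ᶜ ∩ {_x | {Classical.epsilon (· ∈ B σ)} = A}) := by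
      ext x
      by_cases hx : P.lev x = 0 <;> simp [Φ, hx]
    rw [this]
    have h0 := P.measurable_lev (measurableSet_singleton 0)
    exact (h0.inter (MeasurableSet.const _)).union (h0.compl.inter (MeasurableSet.const _))
  have : Countable (ℕ ×ₗ ℕ) := inferInstanceAs (Countable (ℕ × ℕ))
  obtain ⟨F, hFm, hF⟩ := exists_measurable_greedy P.rank P.measurableSet_rank_preimage e he Φ hΦ
  let base : V → Set W := fun x =>
    {Y | ∀ y, G.Adj x y → P.Early y x → ∃ Z ∈ F y, Disjoint Y.1 Z.1}
  have hB : ∀ x, B (fun i => if P.rank (e i x) < P.rank x then some (F (e i x)) else none) =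
      base x := by
    intro x
    ext Y
    constructor
    · intro hY y hxy hy
      obtain ⟨i, rfl⟩ := (hadj x y).1 hxy
      exact hY i _ (if_pos ((P.rank_lt_iff _ _).2 hy))
    · intro hY i A hA
      beta_reduce at hA
      by_cases h : P.rank (e i x) < P.rank x
      · rw [if_pos h] at hA
        obtain rfl := Option.some.inj hA
        exact hY _ ((hadj _ _).2 ⟨i, rfl⟩) ((P.rank_lt_iff _ _).1 h)
      · rw [if_neg h] at hA
        exact absurd hA (by simp)
  have hF0 : ∀ x, P.lev x = 0 → F x = base x := fun x hx => by
    rw [hF x]; simp only [Φ, if_pos hx, hB]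
  let col : V → W := fun x => Classical.epsilon (· ∈ base x)
  have hF1 : ∀ x, P.lev x ≠ 0 → F x = {col x} := fun x hx => by
    rw [hF x]; simp only [Φ, if_neg hx, hB, col]
  refine ⟨F, col, hFm, hF1, fun x Y hY => ?_, fun x hx Y hY => by rw [hF0 x hx]; exact hY⟩
  by_cases hx : P.lev x = 0
  · rw [hF0 x hx] at hY
    exact hY
  · rw [hF1 x hx] at hY
    obtain rfl : Y = col x := hY
    -- The neighbour `y0` is nearer to the paths and hence not early. At most `d - 1` neighbours
    -- constrain `x`, which leaves `k + 1` colours.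
    obtain ⟨y0, hy0, hlt⟩ := P.exists_lev_lt x hx
    obtain ⟨i0, rfl⟩ := (hadj x y0).1 hy0
    have hcard := le_card_freeColours (r := 1) (d := d) (k := k) (fun i => col (e i x))
      (Finset.univ.erase i0) (by
        rw [Finset.card_erase_of_mem (Finset.mem_univ _), Finset.card_univ, Fintype.card_fin]
        omega)
    obtain ⟨Y, hY⟩ := exists_kneserVertex_subset (k := k) ((show k ≤ 1 * k + 1 by omega).trans hcard)
    rw [subset_freeColours_iff] at hY
    have hYb : Y ∈ base x := by
      intro y hxy hy
      obtain ⟨i, rfl⟩ := (hadj x y).1 hxy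
      have hle : P.lev x ≤ P.lev (e i x) := by
        rcases hy with h | h
        · exact h.le
        · exact h.1.le
      have hne : i ≠ i0 := by
        rintro rfl
        omega
      refine ⟨col (e i x), ?_, hY i (by simp [hne])⟩
      rw [hF1 _ (by omega)]
      rfl
    exact Classical.epsilon_spec (p := (· ∈ base x)) ⟨Y, hYb⟩

/-! ### List colouring along the paths. -/

section

variable {d k : ℕ} {V : Type*} [MeasurableSpace V] {G : SimpleGraph V} {e : Fin d → V → V}
  {P : PathLayout G (2 * k + 1)} {F : V → Set (KneserVertex (d * k + 1) k)}
  {col : V → KneserVertex (d * k + 1) k}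

open Classical in
/-- The colours which are not used by the neighbours off the paths. -/
def pathList (P : PathLayout G (2 * k + 1)) (e : Fin d → V → V)
    (col : V → KneserVertex (d * k + 1) k) (x : V) : Finset (Fin (d * k + 1)) :=
  freeColours (fun i => col (e i x)) (Finset.univ.filter fun i => P.lev (e i x) ≠ 0)

theorem le_card_pathList {r : ℕ} {x : V} (J : Finset (Fin d)) (hJ : J.card = r)
    (h : ∀ i ∈ J, P.lev (e i x) = 0) : r * k + 1 ≤ (pathList P e col x).card := by
  classical
  refine le_card_freeColours _ _ ?_
  rw [← hJ, ← Finset.card_union_of_disjoint]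
  · exact (Finset.card_le_univ _).trans_eq (Fintype.card_fin d)
  · rw [Finset.disjoint_left]
    intro i hi hiJ
    exact (Finset.mem_filter.1 hi).2 (h i hiJ)

theorem le_card_pathList_of_adj (hadj : ∀ x y, G.Adj x y ↔ ∃ i, e i x = y) {x y : V}
    (hxy : G.Adj x y) (hy : P.lev y = 0) : k + 1 ≤ (pathList P e col x).card := by
  obtain ⟨i, rfl⟩ := (hadj x y).1 hxy
  simpa using le_card_pathList (r := 1) (col := col) (P := P) {i} (by simp) (by simpa using hy)

theorem le_card_pathList_of_adj_of_adj (hadj : ∀ x y, G.Adj x y ↔ ∃ i, e i x = y) {x y z : V}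
    (hxy : G.Adj x y) (hy : P.lev y = 0) (hxz : G.Adj x z) (hz : P.lev z = 0) (hyz : y ≠ z) :
    2 * k + 1 ≤ (pathList P e col x).card := by
  obtain ⟨i, rfl⟩ := (hadj x y).1 hxy
  obtain ⟨j, rfl⟩ := (hadj x z).1 hxz
  exact le_card_pathList (r := 2) (col := col) (P := P) {i, j}
    (Finset.card_pair fun h => hyz (by rw [h])) (by simpa using ⟨hy, hz⟩)

/-- An early neighbour of a path vertex is either off the paths, where the list already excludes its
colours, or its predecessor on the path. -/
theorem mem_family_of_subset_pathList (hadj : ∀ x y, G.Adj x y ↔ ∃ i, e i x = y)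
    (hcol : ∀ x, P.lev x ≠ 0 → F x = {col x})
    (hF : ∀ x, P.lev x = 0 → ∀ Y, (∀ y, G.Adj x y → P.Early y x → ∃ Z ∈ F y, Disjoint Y.1 Z.1) →
        Y ∈ F x) {x : V} (hx : P.lev x = 0) {Y : KneserVertex (d * k + 1) k}
    (hY : Y.1 ⊆ pathList P e col x)
    (hpred : ∀ y, G.Adj x y → P.lev y = 0 → P.idx x = P.idx y + 1 → ∃ Z ∈ F y, Disjoint Y.1 Z.1) :
    Y ∈ F x := by
  refine hF x hx Y fun y hxy hy => ?_
  by_cases hy0 : P.lev y = 0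
  · refine hpred y hxy hy0 ?_
    have := P.idx_adj x y hxy hx hy0
    rcases hy with h | h <;> omega
  · obtain ⟨i, rfl⟩ := (hadj x y).1 hxy
    rw [pathList, subset_freeColours_iff] at hY
    exact ⟨col (e i x), by rw [hcol _ hy0]; rfl, hY i (by simpa using hy0)⟩

/-- The family itself is hard to describe; this lower bound for it propagates by
`exists_extension_bound`, and at `i = 2k` it covers every `k`-subset of `L`. -/
theorem exists_bound_subset_family (hd : 2 ≤ d) (hadj : ∀ x y, G.Adj x y ↔ ∃ i, e i x = y)
    (hcol : ∀ x, P.lev x ≠ 0 → F x = {col x})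
    (hF : ∀ x, P.lev x = 0 → ∀ Y, (∀ y, G.Adj x y → P.Early y x → ∃ Z ∈ F y, Disjoint Y.1 Z.1) →
        Y ∈ F x) (i : ℕ) (hi : i ≤ 2 * k) (x : V) (hx : P.lev x = 0) (hxi : P.idx x = i) :
    ∃ L C : Finset (Fin (d * k + 1)), C ⊆ L ∧ L.card = 2 * k + 1 ∧ C.card = k + i % 2 ∧
      ∀ Y : KneserVertex (d * k + 1) k, Y.1 ⊆ L → 2 * (Y.1 ∩ C).card ≤ i + 1 → Y ∈ F x := by
  induction i generalizing x with
  | zero =>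
    obtain ⟨y, hxy, hy, -⟩ := P.exists_succ x hx (by omega)
    obtain ⟨D, hD, hDk⟩ := Finset.exists_subset_card_eq
      (le_card_pathList_of_adj (col := col) hadj hxy hy)
    have h2k : 2 * k ≤ d * k := Nat.mul_le_mul_right k hd
    -- Only `k + 1` colours are guaranteed at the first vertex. They are padded to `2k + 1`, and the
    -- padding is taken as `C`: the bound `2 * |Y ∩ C| ≤ 1` makes `Y` avoid it. The room for padding
    -- comes from `d ≥ 2`.
    obtain ⟨L, hDL, -, hL⟩ := Finset.exists_subsuperset_card_eq (n := 2 * k + 1)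
      (Finset.subset_univ D) (by omega) (by rw [Finset.card_univ, Fintype.card_fin]; omega)
    refine ⟨L, L \ D, Finset.sdiff_subset, hL, ?_, fun Y hYL hY => ?_⟩
    · rw [Finset.card_sdiff_of_subset hDL]; omega
    · refine mem_family_of_subset_pathList hadj hcol hF hx ?_ fun y _ _ h => by omega
      have h0 : Y.1 ∩ (L \ D) = ∅ := Finset.card_eq_zero.1 (by omega)
      intro a ha
      refine hD (by_contra fun haD => ?_)
      have : a ∈ Y.1 ∩ (L \ D) := Finset.mem_inter.2 ⟨ha, Finset.mem_sdiff.2 ⟨hYL ha, haD⟩⟩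
      rw [h0] at this
      exact Finset.notMem_empty a this
  | succ i ih =>
    obtain ⟨y, hxy, hy, hyi⟩ := P.exists_pred x hx (by omega)
    obtain ⟨z, hxz, hz, hzi⟩ := P.exists_succ x hx (by omega)
    obtain ⟨L, C, hCL, hL, hC, hLC⟩ := ih (by omega) y hy (by omega)
    obtain ⟨L', hL', hL'k⟩ := Finset.exists_subset_card_eq
      (le_card_pathList_of_adj_of_adj (col := col) hadj hxy hy hxz hz
        (by rintro rfl; omega))
    obtain ⟨C', hC'L', hC'k, hext⟩ := exists_extension_bound hCL hL hC hL'k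
    refine ⟨L', C', hC'L', hL'k, hC'k, fun Y hYL hY => ?_⟩
    refine mem_family_of_subset_pathList hadj hcol hF hx (hYL.trans hL') fun y' hxy' hy' h => ?_
    obtain rfl := P.eq_of_idx_eq x y y' hxy hxy' hx hy hy' (by omega)
    obtain ⟨Z, hZL, hZk, hZC, hYZ⟩ := hext Y.1 hYL Y.2 hY
    exact ⟨⟨Z, hZk⟩, hLC ⟨Z, hZk⟩ hZL hZC, hYZ⟩

theorem family_nonempty_of_idx_eq (hd : 2 ≤ d) (hadj : ∀ x y, G.Adj x y ↔ ∃ i, e i x = y)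
    (hcol : ∀ x, P.lev x ≠ 0 → F x = {col x})
    (hF : ∀ x, P.lev x = 0 → ∀ Y, (∀ y, G.Adj x y → P.Early y x → ∃ Z ∈ F y, Disjoint Y.1 Z.1) →
        Y ∈ F x) (x : V) (hx : P.lev x = 0) (hxi : P.idx x = 2 * k + 1) : (F x).Nonempty := by
  obtain ⟨y, hxy, hy, hyi⟩ := P.exists_pred x hx (by omega)
  obtain ⟨L, C, hCL, hL, hC, hLC⟩ :=
    exists_bound_subset_family hd hadj hcol hF (2 * k) le_rfl y hy (by omega)
  obtain ⟨Y, hY⟩ := exists_kneserVertex_subset (k := k)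
    ((Nat.le_succ k).trans (le_card_pathList_of_adj (col := col) hadj hxy hy))
  refine ⟨Y, mem_family_of_subset_pathList hadj hcol hF hx hY fun y' hxy' hy' h => ?_⟩
  obtain rfl := P.eq_of_idx_eq x y y' hxy hxy' hx hy hy' (by omega)
  -- Since `y` has position `2k`, any `k`-subset of `L` is admissible there, and at least `k + 1`
  -- elements of `L` lie outside `Y`.
  obtain ⟨Z, hZ⟩ := exists_kneserVertex_subset (k := k) (L := L \ Y.1) (by
    have := Finset.le_card_sdiff Y.1 L
    rw [Y.2] at this
    omega)
  refine ⟨Z, hLC Z (hZ.trans Finset.sdiff_subset) ?_, Finset.disjoint_sdiff.mono_right hZ⟩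
  have := Finset.card_le_card (Finset.inter_subset_left (s₁ := Z.1) (s₂ := C))
  rw [Z.2] at this
  omega

/-! ### Backward pass and conclusion. -/

/-- The paths are coloured backwards, every colour being chosen from the family of admissible
ones. -/
theorem exists_measurable_choice (he : ∀ i, Measurable (e i))
    (hadj : ∀ x y, G.Adj x y ↔ ∃ i, e i x = y)
    (hFm : ∀ A, MeasurableSet (F ⁻¹' {A}))
    (hcol : ∀ x, P.lev x ≠ 0 → F x = {col x})
    (hF : ∀ x, ∀ Y ∈ F x, ∀ y, G.Adj x y → P.Early y x → ∃ Z ∈ F y, Disjoint Y.1 Z.1)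
    (hlast : ∀ x, P.lev x = 0 → P.idx x = 2 * k + 1 → (F x).Nonempty) :
    ∃ f : V → KneserVertex (d * k + 1) k, (∀ a, MeasurableSet (f ⁻¹' {a})) ∧
      ∀ x y, G.Adj x y → Disjoint (f x).1 (f y).1 := by
  classical
  by_cases hV : Nonempty V
  swap
  · have : ∀ x : V, False := fun x => hV ⟨x⟩
    exact ⟨fun x => (this x).elim, fun a => by
      convert MeasurableSet.empty
      ext x; exact (this x).elim, fun x => (this x).elim⟩
  obtain ⟨x₀⟩ := hV
  let W := KneserVertex (d * k + 1) k
  have : Nonempty W := ⟨col x₀⟩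
  -- Points off the paths get rank `0`; on the paths the rank is positive, because positions are at
  -- most `2k + 1`, and decreases towards the last vertex.
  let ρ : V → ℕ := fun x => if P.lev x = 0 then 2 * k + 2 - P.idx x else 0
  have hρ : Measurable ρ := Measurable.ite (P.measurable_lev (measurableSet_singleton 0))
    (measurable_from_nat.comp P.measurable_idx) measurable_const
  have hρ0 : ∀ x, P.lev x ≠ 0 → ρ x = 0 := fun x hx => if_neg hx
  have hρ1 : ∀ x, P.lev x = 0 → ρ x = 2 * k + 2 - P.idx x := fun x hx => if_pos hx
  let Ψ : Set W → (Fin d → Option W) → W := fun A σ =>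
    Classical.epsilon fun Y => Y ∈ A ∧ ∀ i Z, σ i = some Z → Disjoint Y.1 Z.1
  have hΨ : ∀ σ a, MeasurableSet {x | Ψ (F x) σ = a} := by
    intro σ a
    have : {x | Ψ (F x) σ = a} = ⋃ A : {A : Set W // Ψ A σ = a}, F ⁻¹' {A.1} := by
      ext x; simp
    rw [this]
    exact MeasurableSet.iUnion fun A => hFm A.1
  obtain ⟨f, hfm, hf⟩ := exists_measurable_greedy ρ (fun q => hρ (measurableSet_singleton q)) e he
    (fun x => Ψ (F x)) hΨ
  have hchoose : ∀ x, (∃ Y ∈ F x, ∀ y, G.Adj x y → ρ y < ρ x → Disjoint Y.1 (f y).1) →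
      f x ∈ F x ∧ ∀ y, G.Adj x y → ρ y < ρ x → Disjoint (f x).1 (f y).1 := by
    rintro x ⟨Y, hY, hYd⟩
    have := Classical.epsilon_spec (p := fun Y : W => Y ∈ F x ∧ ∀ i Z,
      (if ρ (e i x) < ρ x then some (f (e i x)) else none) = some Z → Disjoint Y.1 Z.1)
      ⟨Y, hY, fun i Z h => by
        split_ifs at h with hlt
        obtain rfl := Option.some.inj h
        exact hYd _ ((hadj _ _).2 ⟨i, rfl⟩) hlt⟩
    change Ψ (F x) _ ∈ F x ∧ _ at this
    rw [hf x]
    refine ⟨this.1, fun y hxy hlt => ?_⟩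
    obtain ⟨i, rfl⟩ := (hadj x y).1 hxy
    exact this.2 i _ (if_pos hlt)
  have key : ∀ n x, ρ x = n →
      f x ∈ F x ∧ ∀ y, G.Adj x y → ρ y < ρ x → Disjoint (f x).1 (f y).1 := by
    intro n
    induction n using Nat.strong_induction_on with
    | _ n ih =>
    rintro x rfl
    apply hchoose
    by_cases hx : P.lev x = 0
    swap
    · refine ⟨col x, by rw [hcol x hx]; rfl, fun y _ h => ?_⟩
      rw [hρ0 x hx] at h
      exact absurd h (Nat.not_lt_zero _)
    -- Any choice from `F x` agrees with the neighbours off the paths, whose families are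
    -- singletons. Only the successor on the path restricts the choice.
    have hoff : ∀ Y ∈ F x, ∀ y, G.Adj x y → ρ y < ρ x → P.lev y ≠ 0 →
        Disjoint Y.1 (f y).1 := by
      intro Y hY y hxy hlt hy
      obtain ⟨Z, hZ, hYZ⟩ := hF x Y hY y hxy (Or.inl (by omega))
      have hfy := (ih _ hlt y rfl).1
      rw [hcol y hy] at hZ hfy
      obtain rfl : Z = col y := hZ
      rwa [show f y = col y from hfy]
    have hle := P.idx_le x hx
    by_cases hxm : P.idx x = 2 * k + 1
    · obtain ⟨Y, hY⟩ := hlast x hx hxm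
      refine ⟨Y, hY, fun y hxy hlt => hoff Y hY y hxy hlt fun hy => ?_⟩
      have := P.idx_le y hy
      rw [hρ1 x hx, hρ1 y hy] at hlt
      omega
    · obtain ⟨z, hxz, hz, hzi⟩ := P.exists_succ x hx (by omega)
      have hlt : ρ z < ρ x := by
        rw [hρ1 x hx, hρ1 z hz]; omega
      -- The colour of the successor `z` lies in `F z`, and membership there provides a compatible
      -- member of the family of its predecessor `x`.
      obtain ⟨Y, hY, hYd⟩ := hF z (f z) (ih _ hlt z rfl).1 x hxz.symm
        (Or.inr ⟨by omega, by omega⟩)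
      refine ⟨Y, hY, fun y hxy hlt' => ?_⟩
      by_cases hy : P.lev y = 0
      · have := P.idx_adj x y hxy hx hy
        rw [hρ1 x hx, hρ1 y hy] at hlt'
        obtain rfl := P.eq_of_idx_eq x y z hxy hxz hx hy hz (by omega)
        exact hYd.symm
      · exact hoff Y hY y hxy hlt' hy
  have hoff : ∀ x y, G.Adj x y → P.lev x ≠ 0 → P.lev y ≠ 0 → P.Early y x →
      Disjoint (f x).1 (f y).1 := by
    intro x y hxy hx hy h
    have hfy := (key _ y rfl).1
    obtain ⟨Z, hZ, hYZ⟩ := hF x (f x) (key _ x rfl).1 y hxy h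
    rw [hcol y hy] at hZ hfy
    obtain rfl : Z = col y := hZ
    rwa [show f y = col y from hfy]
  refine ⟨f, hfm, fun x y hxy => ?_⟩
  by_cases h : P.lev x ≠ 0 ∧ P.lev y ≠ 0
  · have hne := P.idx_ne x y hxy h.1 h.2
    have : P.Early y x ∨ P.Early x y := by
      unfold PathLayout.Early; omega
    rcases this with h' | h'
    · exact hoff x y hxy h.1 h.2 h'
    · exact (hoff y x hxy.symm h.2 h.1 h').symm
  -- If an endpoint is on a path, the endpoints have different ranks and the later choice respected
  -- the earlier one. Edges off the paths, where both ranks are `0`, were settled in the forward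
  -- pass.
  · have hne : ρ x ≠ ρ y := by
      by_cases hx : P.lev x = 0 <;> by_cases hy : P.lev y = 0
      · have := P.idx_adj x y hxy hx hy
        have := P.idx_le x hx
        have := P.idx_le y hy
        rw [hρ1 x hx, hρ1 y hy]; omega
      · have := P.idx_le x hx
        rw [hρ1 x hx, hρ0 y hy]; omega
      · have := P.idx_le y hy
        rw [hρ0 x hx, hρ1 y hy]; omega
      · exact absurd ⟨hx, hy⟩ h
    rcases lt_or_gt_of_ne hne with h' | h'
    · exact ((key _ y rfl).2 x hxy.symm h').symm
    · exact (key _ x rfl).2 y hxy h'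

end

theorem mainTheorem6 (d k : ℕ) (hd : 2 ≤ d)
    {V : Type*} [MeasurableSpace V] [StandardBorelSpace V]
    (G : SimpleGraph V) [G.LocallyFinite] (hBorel : IsBorelGraph G)
    (hreg : G.IsRegularOfDegree d) (hforest : G.IsAcyclic) :
    ∃ f : V → KneserVertex (d * k + 1) k, IsBorelHom G (kneserGraph (d * k + 1) k) f := by
  obtain ⟨e, he, hinj, hadj⟩ := exists_measurable_neighbor_enum G hBorel hreg
  obtain ⟨P⟩ := nonempty_pathLayout hd hforest he hinj hadj (2 * k + 1)
  obtain ⟨F, col, hFm, hcol, hF, hF'⟩ :=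
    exists_measurable_family (d := d) (k := k) (by omega) he hadj P
  obtain ⟨f, hfm, hf⟩ := exists_measurable_choice he hadj hFm hcol hF
    (family_nonempty_of_idx_eq hd hadj hcol hF')
  exact ⟨f, measurable_to_countable' hfm, hf⟩
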